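/- Let $N$ parties be given, the $p$-th with state space $\mathbb{C}^{d_p}$, and let $\mathcal{S}=\{|\psi_1\rangle,\dots,|\psi_n\rangle\}\subset\bigotimes_{p=1}^N\mathbb{C}^{d_p}$ be a set of $n$ orthonormal states known to the parties. Let $1\le m<n$. For distinct indices $a_1,\dots,a_m$, unknown to the parties, they share $|\psi_{a_1}\rangle\otimes\cdots\otimes|\psi_{a_m}\rangle$, each party holding its $m$ subsystems. An LOCC protocol consists of finitely many rounds, in each of which one party performs a quantum measurement (possibly with ancillas) on its own system and announces the outcome to all the others; later measurements and the final output may depend on all earlier outcomes. $\mathcal{S}$ is called $(n,m)$-identifiable if a single LOCC protocol determines the set $\{a_1,\dots,a_m\}$ with probability $1$ for every choice of $(a_1,\dots,a_m)$, and $(n,m)$-markable if a single LOCC protocol determines the tuple $(a_1,\dots,a_m)$ with probability $1$ for every such choice. **Theorem.** An $(n,m)$-identifiable set of orthonormal states need not be $(n,m)$-markable. More precisely, let $$|B_1\rangle=\tfrac{1}{\sqrt2}(|00\rangle+|11\rangle),\quad |B_2\rangle=\tfrac{1}{\sqrt2}(|00\rangle-|11\rangle),\quad |B_3\rangle=\tfrac{1}{\sqrt2}(|01\rangle+|10\rangle),\quad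 |B_4\rangle=\tfrac{1}{\sqrt2}(|01\rangle-|10\rangle)$$ in $\mathbb{C}^2\otimes\mathbb{C}^2$, shared by two parties. Let $\mathcal{S}$ be any set of three of these four states, for example $\{|B_1\rangle,|B_2\rangle,|B_3\rangle\}$. Then $\mathcal{S}$ is orthonormal and $(3,2)$-identifiable, by the protocol in which each party measures its own two qubits in the basis $|B_1\rangle,\dots,|B_4\rangle$ and the subset is then read off from the two outcomes; but $\mathcal{S}$ is not $(3,2)$-markable. -/

import Mathlib

noncomputable section

namespace LocalSubset

open scoped Matrix

/-- Pure states (as vectors) of a finite family of systems; party `p` holds a system with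
orthonormal basis `X p`, so this is `⨂ₚ ℂ^(X p)` in its product basis. -/
abbrev Vec {P : Type} (X : P → Type) : Type := EuclideanSpace ℂ (∀ p, X p)

section Protocols

variable {P : Type} [Fintype P] [DecidableEq P]

/-- The operator `M` on party `p`, tensored with the identity on all other parties. -/
def applyAt {Z : P → Type} [∀ p, Fintype (Z p)] (p : P) (M : Matrix (Z p) (Z p) ℂ)
    (ψ : Vec Z) : Vec Z :=
  WithLp.toLp 2 fun z => ∑ x : Z p, M (z p) x * ψ (Function.update z p x)

/-- The operator `⨂ₚ V p`. -/
def applyLocal {X Z : P → Type} [∀ p, Fintype (X p)]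
    (V : ∀ p, Matrix (Z p) (X p) ℂ) (ψ : Vec X) : Vec Z :=
  WithLp.toLp 2 fun z => ∑ x : ∀ p, X p, (∏ p, V p (z p) (x p)) * ψ x

/-- The rounds of a protocol. Either the protocol stops with output `l`, or one party `p` performs
a measurement with Kraus operators `M o` on its own system and announces the outcome `o` to
everybody; all that follows may depend on it. -/
inductive Rounds (Z : P → Type) [∀ p, Fintype (Z p)] [∀ p, DecidableEq (Z p)] (L : Type) : Type
  | output (l : L) : Rounds Z L
  | measure (p : P) (r : ℕ) (M : Fin r → Matrix (Z p) (Z p) ℂ)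
      (complete : ∑ o, (M o)ᴴ * M o = 1) (next : Fin r → Rounds Z L) : Rounds Z L

/-- The probability that the output is `l` when the rounds are run on `ψ`. The vector passed on
after each measurement is not normalized: its squared norm is the probability of the transcript. -/
def Rounds.prob {Z : P → Type} [∀ p, Fintype (Z p)] [∀ p, DecidableEq (Z p)] {L : Type}
    [DecidableEq L] (l : L) : Rounds Z L → Vec Z → ℝ
  | .output l', ψ => if l' = l then ‖ψ‖ ^ 2 else 0
  | .measure p _ M _ next, ψ => ∑ o, (next o).prob l (applyAt p (M o) ψ)

/-- An LOCC protocol (local operations and classical communication) with outputs in `L`, for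
parties that hold the systems `X p`: every party embeds its system isometrically into a
finite-dimensional one of any size (this adjoins ancillas in a fixed state, so that general Kraus
operators become square ones), and then they run finitely many rounds of local measurements and
broadcasts. -/
structure LOCC (X : P → Type) [∀ p, Fintype (X p)] [∀ p, DecidableEq (X p)] (L : Type) where
  /-- The local systems, including ancillas. -/
  space : P → Type
  [fintypeSpace : ∀ p, Fintype (space p)]
  [decEqSpace : ∀ p, DecidableEq (space p)]
  /-- The local embeddings. -/
  embed : ∀ p, Matrix (space p) (X p) ℂ
  isometry : ∀ p, (embed p)ᴴ * embed p = 1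
  rounds : Rounds space L

/-- The probability that the protocol outputs `l` on the shared state `ψ`. -/
def LOCC.prob {X : P → Type} [∀ p, Fintype (X p)] [∀ p, DecidableEq (X p)] {L : Type}
    [DecidableEq L] (π : LOCC X L) (ψ : Vec X) (l : L) : ℝ :=
  letI := π.fintypeSpace
  letI := π.decEqSpace
  π.rounds.prob l (applyLocal π.embed ψ)

/-- Party `p`'s system when `m` states are distributed: `m` copies of `X p`. -/
abbrev Copies (X : P → Type) (m : ℕ) : P → Type := fun p => Fin m → X p

variable {X : P → Type} {n m : ℕ}

/-- The state `ψ (a 0) ⊗ ⋯ ⊗ ψ (a (m - 1))`, regrouped so that each party holds its share of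
every factor. -/
def shared (ψ : Fin n → Vec X) (a : Fin m ↪ Fin n) : Vec (Copies X m) :=
  WithLp.toLp 2 fun x => ∏ k, ψ (a k) fun p => x p k

variable [∀ p, Fintype (X p)] [∀ p, DecidableEq (X p)]

/-- The protocol determines with certainty which `m` distinct members of the family are shared,
whatever they are and in whatever order they come. -/
def LOCC.Identifies (π : LOCC (Copies X m) (Finset (Fin n))) (ψ : Fin n → Vec X) : Prop :=
  ∀ a : Fin m ↪ Fin n, π.prob (shared ψ a) (Finset.univ.map a) = 1

/-- The protocol determines with certainty which `m` distinct members of the family are shared,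
and in which order. -/
def LOCC.Marks (π : LOCC (Copies X m) (Fin m ↪ Fin n)) (ψ : Fin n → Vec X) : Prop :=
  ∀ a : Fin m ↪ Fin n, π.prob (shared ψ a) a = 1

/-- `(n, m)`-identifiability of a family of `n` states. -/
def Identifiable (ψ : Fin n → Vec X) (m : ℕ) : Prop :=
  ∃ π : LOCC (Copies X m) (Finset (Fin n)), π.Identifies ψ

/-- `(n, m)`-markability of a family of `n` states. -/
def Markable (ψ : Fin n → Vec X) (m : ℕ) : Prop :=
  ∃ π : LOCC (Copies X m) (Fin m ↪ Fin n), π.Marks ψ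

end Protocols

section Bell

/-- Two parties with one qubit each. -/
abbrev Qubits : Fin 2 → Type := fun _ => Fin 2

/-- The product basis vector `|s t⟩` of two qubits. -/
def ket (s t : Fin 2) : EuclideanSpace ℂ (Fin 2 → Fin 2) := EuclideanSpace.single ![s, t] 1

/-- The four Bell states of two qubits. -/
def bell : Fin 4 → EuclideanSpace ℂ (Fin 2 → Fin 2) :=
  ![(1 / (Real.sqrt 2 : ℂ)) • (ket 0 0 + ket 1 1),
    (1 / (Real.sqrt 2 : ℂ)) • (ket 0 0 - ket 1 1),
    (1 / (Real.sqrt 2 : ℂ)) • (ket 0 1 + ket 1 0),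
    (1 / (Real.sqrt 2 : ℂ)) • (ket 0 1 - ket 1 0)]

/-- Three of the four Bell states, as states shared between the two parties. -/
def threeBell (e : Fin 3 ↪ Fin 4) : Fin 3 → Vec Qubits := fun i => bell (e i)

/-- The projector `|Bᵢ⟩⟨Bᵢ|`. -/
def bellProj (i : Fin 4) : Matrix (Fin 2 → Fin 2) (Fin 2 → Fin 2) ℂ :=
  Matrix.of fun x y => bell i x * star (bell i y)

theorem bellProj_complete : ∑ i, (bellProj i)ᴴ * bellProj i = 1 := by
  have h : ((Real.sqrt 2 : ℝ) : ℂ) * (Real.sqrt 2 : ℝ) = 2 := by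
    rw [← Complex.ofReal_mul, Real.mul_self_sqrt (by norm_num)]; norm_num
  have h0 : ((Real.sqrt 2 : ℝ) : ℂ) ≠ 0 := by
    intro h0; simp [h0] at h
  have hi : ((Real.sqrt 2 : ℝ) : ℂ)⁻¹ * ((Real.sqrt 2 : ℝ) : ℂ)⁻¹ = 1 / 2 := by
    rw [← mul_inv, h]; norm_num
  have hs : ∀ f : (Fin 2 → Fin 2) → ℂ,
      ∑ z, f z = f ![0, 0] + f ![0, 1] + f ![1, 0] + f ![1, 1] := by
    intro f
    rw [← (finTwoArrowEquiv (Fin 2)).symm.sum_comp, Fintype.sum_prod_type]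
    simp [Fin.sum_univ_two, add_assoc]
  have hx : ∀ x : Fin 2 → Fin 2, x = ![0, 0] ∨ x = ![0, 1] ∨ x = ![1, 0] ∨ x = ![1, 1] := by
    decide
  ext x y
  rw [Matrix.sum_apply]
  simp only [Matrix.mul_apply, Matrix.conjTranspose_apply, hs, Fin.sum_univ_four]
  rcases hx x with rfl | rfl | rfl | rfl <;> rcases hx y with rfl | rfl | rfl | rfl <;>
    simp [bellProj, bell, ket] <;> grind

/-- Two states of a two-qubit system are shared, so each party holds two qubits. Each party
measures its own two qubits in the Bell basis, and the output `out i j` is read off from the two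
outcomes `i` (party `0`) and `j` (party `1`). -/
def bellProtocol {L : Type} (out : Fin 4 → Fin 4 → L) : LOCC (Copies Qubits 2) L where
  space := Copies Qubits 2
  embed := fun _ => 1
  isometry := fun _ => by simp
  rounds := .measure 0 4 bellProj bellProj_complete fun i =>
    .measure 1 4 bellProj bellProj_complete fun j => .output (out i j)

end Bell

end LocalSubset

end

noncomputable section

namespace LocalSubset

open scoped Matrix

/-! ### Counting bound for LOCC discrimination of entangled states. -/

section General

variable {P : Type} [Fintype P] [DecidableEq P]

/-! Label the Bell states by the Klein four-group, here `Fin 4` under xor: the high bit is the bit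
flip, the low bit the sign. By entanglement swapping, Bell measurements by both parties on `B_a ⊗
B_b` give outcomes with `i ^^^ j = a ^^^ b`. Among three distinct group elements, cancellation makes
the three pairwise products distinct, so the product reveals the pair.

Marking fails by counting. Each LOCC transcript acts as a product operator, and by Cauchy–Schwarz
(`productBounded_of_equiv`) such an operator gives a maximally entangled state of `4 ⊗ 4` at most
1/4 of the total weight it gives the 16 product basis vectors. Summing over transcripts
(`card_le_of_distinguishes`), at most 16/4 = 4 such states can be distinguished, but there are 6
ordered pairs. -/

theorem sum_norm_sq_mulVec {ι κ : Type*} [Fintype ι] [Fintype κ] [DecidableEq κ]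
    (M : ι → Matrix κ κ ℂ) (hM : ∑ o, (M o)ᴴ * M o = 1) (v : κ → ℂ) :
    ∑ o, ∑ y, ‖(M o *ᵥ v) y‖ ^ 2 = ∑ y, ‖v y‖ ^ 2 := by
  have key : ∑ o, star (M o *ᵥ v) ⬝ᵥ (M o *ᵥ v) = star v ⬝ᵥ v := by
    have h : ∀ o, star (M o *ᵥ v) ⬝ᵥ (M o *ᵥ v) = star v ⬝ᵥ (((M o)ᴴ * M o) *ᵥ v) := fun o => by
      rw [Matrix.star_mulVec, ← Matrix.dotProduct_mulVec, Matrix.mulVec_mulVec]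
    simp_rw [h]
    rw [← dotProduct_sum, ← Matrix.sum_mulVec, hM, Matrix.one_mulVec]
  have hs : ∀ w : κ → ℂ, star w ⬝ᵥ w = ((∑ y, ‖w y‖ ^ 2 : ℝ) : ℂ) := fun w => by
    simp [dotProduct, Complex.conj_mul']
  simp_rw [hs] at key
  exact_mod_cast key

/-- The outcome probabilities of a local measurement add up to the squared norm of the state. -/
theorem sum_norm_sq_applyAt {Z : P → Type} [∀ p, Fintype (Z p)] [∀ p, DecidableEq (Z p)]
    {ι : Type*} [Fintype ι] (p : P) (M : ι → Matrix (Z p) (Z p) ℂ)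
    (hM : ∑ o, (M o)ᴴ * M o = 1) (ψ : Vec Z) :
    ∑ o, ‖applyAt p (M o) ψ‖ ^ 2 = ‖ψ‖ ^ 2 := by
  -- With the other parties' coordinates `w` frozen, `applyAt` is plain matrix-vector multiplication
  -- on the slice.
  let E := (Equiv.piSplitAt p Z).symm
  have hE : ∀ y x w, Function.update (E (y, w)) p x = E (x, w) := by
    intro y x w
    funext q
    by_cases h : q = p
    · subst h; simp [E, Equiv.piSplitAt]
    · simp [E, Equiv.piSplitAt, h]
  have hEp : ∀ y w, E (y, w) p = y := fun y w => by simp [E, Equiv.piSplitAt]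
  have hsum : ∀ φ : Vec Z, ‖φ‖ ^ 2 = ∑ w, ∑ y, ‖φ (E (y, w))‖ ^ 2 := by
    intro φ
    rw [EuclideanSpace.norm_sq_eq, ← E.sum_comp, Fintype.sum_prod_type_right]
  simp_rw [hsum]
  rw [Finset.sum_comm]
  refine Finset.sum_congr rfl fun w _ => ?_
  rw [← sum_norm_sq_mulVec M hM fun y => ψ (E (y, w))]
  simp [applyAt, Matrix.mulVec, dotProduct, hE, hEp]

theorem Rounds.sum_prob {Z : P → Type} [∀ p, Fintype (Z p)] [∀ p, DecidableEq (Z p)] {L : Type}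
    [Fintype L] [DecidableEq L] (R : Rounds Z L) (ψ : Vec Z) : ∑ l, R.prob l ψ = ‖ψ‖ ^ 2 := by
  induction R generalizing ψ with
  | output l' => simp [Rounds.prob]
  | measure p r M hM next ih =>
    simp only [Rounds.prob]
    rw [Finset.sum_comm, ← sum_norm_sq_applyAt p M hM ψ]
    exact Finset.sum_congr rfl fun o _ => ih o _

/-- Absorbing each Kraus operator into its party's factor keeps the accumulated operator a product
along every transcript. -/
theorem applyAt_applyLocal {X Z : P → Type} [∀ p, Fintype (X p)] [∀ p, Fintype (Z p)]
    (p : P) (M : Matrix (Z p) (Z p) ℂ) (V : ∀ p, Matrix (Z p) (X p) ℂ) (ψ : Vec X) :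
    applyAt p M (applyLocal V ψ) = applyLocal (Function.update V p (M * V p)) ψ := by
  ext z
  simp only [applyAt, applyLocal, Finset.mul_sum]
  rw [Finset.sum_comm]
  refine Finset.sum_congr rfl fun x _ => ?_
  rw [← Finset.mul_prod_erase _ _ (Finset.mem_univ p)]
  rw [Function.update_self, Matrix.mul_apply, Finset.sum_mul, Finset.sum_mul]
  refine Finset.sum_congr rfl fun y _ => ?_
  rw [← Finset.mul_prod_erase _ (fun q => V q _ _) (Finset.mem_univ p), Function.update_self]
  have : ∀ q ∈ Finset.univ.erase p, V q (Function.update z p y q) (x q)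
      = Function.update V p (M * V p) q (z q) (x q) := fun q hq => by
    have := Finset.ne_of_mem_erase hq
    simp [this]
  rw [Finset.prod_congr rfl this]
  ring

theorem applyLocal_one {X : P → Type} [∀ p, Fintype (X p)] [∀ p, DecidableEq (X p)]
    (ψ : Vec X) : applyLocal (fun p => (1 : Matrix (X p) (X p) ℂ)) ψ = ψ := by
  ext z
  have : ∀ x : ∀ p, X p, (∏ p, (1 : Matrix (X p) (X p) ℂ) (z p) (x p)) = if z = x then 1 else 0 := by
    intro x
    simp only [Matrix.one_apply, Finset.prod_ite_zero, Finset.prod_const_one, Finset.mem_univ,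
      true_implies, funext_iff]
  simp [applyLocal, this]

theorem norm_sq_applyLocal_single {X Z : P → Type} [∀ p, Fintype (X p)] [∀ p, DecidableEq (X p)]
    [∀ p, Fintype (Z p)] (V : ∀ p, Matrix (Z p) (X p) ℂ) (x : ∀ p, X p) :
    ‖applyLocal V (EuclideanSpace.single x 1)‖ ^ 2 = ∏ p, ∑ z, ‖V p z (x p)‖ ^ 2 := by
  rw [EuclideanSpace.norm_sq_eq, Fintype.prod_sum]
  refine Finset.sum_congr rfl fun z _ => ?_
  simp [applyLocal, Finset.prod_pow]

theorem norm_sq_applyLocal_single_of_isometry {X Z : P → Type} [∀ p, Fintype (X p)]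
    [∀ p, DecidableEq (X p)] [∀ p, Fintype (Z p)] (V : ∀ p, Matrix (Z p) (X p) ℂ)
    (hV : ∀ p, (V p)ᴴ * V p = 1) (x : ∀ p, X p) :
    ‖applyLocal V (EuclideanSpace.single x 1)‖ ^ 2 = 1 := by
  rw [norm_sq_applyLocal_single]
  refine Finset.prod_eq_one fun p _ => ?_
  have h := congrFun (congrFun (hV p) (x p)) (x p)
  simp only [Matrix.mul_apply, Matrix.conjTranspose_apply, Matrix.one_apply_eq, RCLike.star_def,
    Complex.conj_mul'] at h
  exact_mod_cast h

/-- The weight of `ψ` under a product operator is at most `κ` times the sum of the weights of all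
product basis vectors. For a maximally entangled state of two `d`-dimensional systems this holds
with `κ = 1 / d`. -/
def ProductBounded {X : P → Type} [∀ p, Fintype (X p)] [∀ p, DecidableEq (X p)]
    (κ : ℝ) (ψ : Vec X) : Prop :=
  ∀ (Z : P → Type) [∀ p, Fintype (Z p)] (V : ∀ p, Matrix (Z p) (X p) ℂ),
    ‖applyLocal V ψ‖ ^ 2 ≤ κ * ∑ x, ‖applyLocal V (EuclideanSpace.single x 1)‖ ^ 2

/-- Induction on the rounds needs arbitrary `V`: absorbed Kraus operators destroy isometry. At a
leaf the claim is the product bound itself. -/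
theorem ProductBounded.prob_le {X Z : P → Type} [∀ p, Fintype (X p)] [∀ p, DecidableEq (X p)]
    [∀ p, Fintype (Z p)] [∀ p, DecidableEq (Z p)] {L : Type} [DecidableEq L] {κ : ℝ} {ψ : Vec X}
    (hψ : ProductBounded κ ψ) (l : L) (R : Rounds Z L) (V : ∀ p, Matrix (Z p) (X p) ℂ) :
    R.prob l (applyLocal V ψ) ≤
      κ * ∑ x, R.prob l (applyLocal V (EuclideanSpace.single x 1)) := by
  induction R generalizing V with
  | output l' =>
    by_cases h : l' = l
    · simpa [Rounds.prob, h] using hψ Z V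
    · simp [Rounds.prob, h]
  | measure p r M hM next ih =>
    simp only [Rounds.prob, applyAt_applyLocal]
    rw [Finset.sum_comm, Finset.mul_sum]
    exact Finset.sum_le_sum fun o _ => ih o _

/-- At most `κ * D` states with product bound `κ` in a space of total dimension `D` can be
perfectly distinguished by LOCC. -/
theorem card_le_of_distinguishes {X : P → Type} [∀ p, Fintype (X p)] [∀ p, DecidableEq (X p)]
    {L : Type} [Fintype L] [DecidableEq L] {κ : ℝ} (ψ : L → Vec X)
    (hψ : ∀ l, ProductBounded κ (ψ l)) (π : LOCC X L) (hπ : ∀ l, π.prob (ψ l) l = 1) :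
    (Fintype.card L : ℝ) ≤ κ * Fintype.card (∀ p, X p) := by
  let _ := π.fintypeSpace
  let _ := π.decEqSpace
  calc (Fintype.card L : ℝ) = ∑ l, π.rounds.prob l (applyLocal π.embed (ψ l)) := by
        refine Eq.trans ?_ (Finset.sum_congr rfl fun l _ => (hπ l).symm)
        simp
    _ ≤ ∑ l, κ * ∑ x, π.rounds.prob l (applyLocal π.embed (EuclideanSpace.single x 1)) :=
        Finset.sum_le_sum fun l _ => (hψ l).prob_le l π.rounds π.embed
    _ = κ * ∑ x, ‖applyLocal π.embed (EuclideanSpace.single x 1)‖ ^ 2 := by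
        rw [← Finset.mul_sum, Finset.sum_comm]
        simp only [Rounds.sum_prob]
    _ = κ * Fintype.card (∀ p, X p) := by
        simp [norm_sq_applyLocal_single_of_isometry π.embed π.isometry]

/-- A bipartite state whose coefficient matrix is supported on the graph of a bijection. -/
theorem productBounded_of_equiv {X : Fin 2 → Type} [∀ p, Fintype (X p)] [∀ p, DecidableEq (X p)]
    {κ : ℝ} (ψ : Vec X) (σ : X 0 ≃ X 1) (s : X 0 → ℂ) (hs : ∀ x, ‖s x‖ ^ 2 ≤ κ)
    (hψ : ∀ x, ψ x = if x 1 = σ (x 0) then s (x 0) else 0) : ProductBounded κ ψ := by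
  intro Z _ V
  have hκ : ∀ x : X 0, 0 ≤ κ := fun x => (sq_nonneg _).trans (hs x)
  have hval : ∀ z, applyLocal V ψ z = ∑ x, V 0 (z 0) x * s x * V 1 (z 1) (σ x) := by
    intro z
    simp only [applyLocal, Fin.prod_univ_two, hψ]
    rw [← (piFinTwoEquiv X).symm.sum_comp, Fintype.sum_prod_type]
    refine Finset.sum_congr rfl fun x _ => ?_
    simp [piFinTwoEquiv, mul_right_comm]
  -- Cauchy–Schwarz along the graph of `σ`. Summed over `z`, the right side becomes `κ` times the
  -- product of the squared Frobenius norms of `V 0` and `V 1`, which is the total weight of the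
  -- product basis.
  have hb : ∀ z, ‖applyLocal V ψ z‖ ^ 2 ≤
      κ * ((∑ x, ‖V 0 (z 0) x‖ ^ 2) * ∑ y, ‖V 1 (z 1) y‖ ^ 2) := by
    intro z
    rw [hval, ← σ.sum_comp]
    calc _ ≤ (∑ x, ‖V 0 (z 0) x * s x‖ * ‖V 1 (z 1) (σ x)‖) ^ 2 := by
          gcongr
          simpa only [norm_mul] using norm_sum_le Finset.univ
            fun x => V 0 (z 0) x * s x * V 1 (z 1) (σ x)
      _ ≤ (∑ x, ‖V 0 (z 0) x * s x‖ ^ 2) * ∑ x, ‖V 1 (z 1) (σ x)‖ ^ 2 :=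
          Finset.sum_mul_sq_le_sq_mul_sq _ _ _
      _ ≤ (κ * ∑ x, ‖V 0 (z 0) x‖ ^ 2) * ∑ x, ‖V 1 (z 1) (σ x)‖ ^ 2 := by
          gcongr
          rw [Finset.mul_sum]
          gcongr with x
          rw [norm_mul, mul_pow, mul_comm]
          gcongr
          exact hs x
      _ = _ := by ring
  have hsplit : ∀ (W : Fin 2 → Type) [∀ p, Fintype (W p)] (f : W 0 → ℝ) (g : W 1 → ℝ),
      ∑ x : ∀ p, W p, f (x 0) * g (x 1) = (∑ x, f x) * ∑ y, g y := by
    intro W _ f g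
    rw [← (piFinTwoEquiv W).symm.sum_comp, Fintype.sum_prod_type, Finset.sum_mul_sum]
    simp [piFinTwoEquiv]
  calc ‖applyLocal V ψ‖ ^ 2 = ∑ z, ‖applyLocal V ψ z‖ ^ 2 := EuclideanSpace.norm_sq_eq _
    _ ≤ ∑ z : ∀ p, Z p, κ * ((∑ x, ‖V 0 (z 0) x‖ ^ 2) * ∑ y, ‖V 1 (z 1) y‖ ^ 2) :=
        Finset.sum_le_sum fun z _ => hb z
    _ = κ * ∑ x, ‖applyLocal V (EuclideanSpace.single x 1)‖ ^ 2 := by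
        simp only [norm_sq_applyLocal_single, Fin.prod_univ_two]
        rw [← Finset.mul_sum, hsplit Z (fun z => ∑ x, ‖V 0 z x‖ ^ 2) fun z => ∑ x, ‖V 1 z x‖ ^ 2,
          hsplit X (fun x => ∑ z, ‖V 0 z x‖ ^ 2) fun x => ∑ z, ‖V 1 z x‖ ^ 2,
          Finset.sum_comm, Finset.sum_comm (s := (Finset.univ : Finset (Z 1)))]

end General

/-! ### Integer Bell coefficients and entanglement swapping. -/

/-- Whether the `i`-th Bell state correlates equal (`0`) or opposite (`1`) bits. -/
def bellFlip (i : Fin 4) : Fin 2 := ![0, 0, 1, 1] i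

/-- The sign of the basis vector with first bit `s` in the `i`-th Bell state. -/
def bellSign (i : Fin 4) (s : Fin 2) : ℤ := if s = 1 ∧ (i = 1 ∨ i = 3) then -1 else 1

/-- The coefficients of the Bell states, up to the factor `1 / √2`. -/
def bellCoeff (i : Fin 4) (s t : Fin 2) : ℤ := if t = s + bellFlip i then bellSign i s else 0

theorem inv_sqrt_two_mul_self : (1 / (Real.sqrt 2 : ℂ)) * (1 / (Real.sqrt 2 : ℂ)) = 1 / 2 := by
  rw [div_mul_div_comm, ← Complex.ofReal_mul, Real.mul_self_sqrt (by norm_num)]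
  norm_num

theorem bell_apply (i : Fin 4) (x : Fin 2 → Fin 2) :
    bell i x = (1 / (Real.sqrt 2 : ℂ)) * bellCoeff i (x 0) (x 1) := by
  have hx : ∀ x : Fin 2 → Fin 2, x = ![0, 0] ∨ x = ![0, 1] ∨ x = ![1, 0] ∨ x = ![1, 1] := by
    decide
  rcases hx x with rfl | rfl | rfl | rfl <;> fin_cases i <;>
    simp [bell, ket, bellCoeff, bellFlip, bellSign]

theorem star_bell_apply (i : Fin 4) (x : Fin 2 → Fin 2) : star (bell i x) = bell i x := by
  simp [bell_apply]

theorem sum_bellCoeff_mul (i j : Fin 4) :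
    ∑ x : Fin 2 → Fin 2, bellCoeff i (x 0) (x 1) * bellCoeff j (x 0) (x 1) =
      if i = j then 2 else 0 := by
  revert i j; decide

theorem orthonormal_bell : Orthonormal ℂ bell := by
  rw [orthonormal_iff_ite]
  intro i j
  have h : ∀ x, bell j x * (starRingEnd ℂ) (bell i x) =
      1 / 2 * ((bellCoeff i (x 0) (x 1) * bellCoeff j (x 0) (x 1) : ℤ) : ℂ) := by
    intro x
    rw [← RCLike.star_def, star_bell_apply, bell_apply, bell_apply, ← inv_sqrt_two_mul_self]
    push_cast; ring
  simp only [PiLp.inner_apply, RCLike.inner_apply, h]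
  rw [← Finset.mul_sum, ← Int.cast_sum, sum_bellCoeff_mul]
  split_ifs <;> norm_num

/-- Entanglement swapping: Bell measurements on the halves of `|Bₐ⟩ ⊗ |B_b⟩` only give outcomes
`i`, `j` with `i + j = a + b` in the Klein four-group. -/
theorem sum_bellCoeff_swap (i j a b : Fin 4) (h : i ^^^ j ≠ a ^^^ b) :
    ∑ s, ∑ t, ∑ u, ∑ v,
      bellCoeff i s t * bellCoeff j u v * (bellCoeff a s u * bellCoeff b t v) = 0 := by
  revert i j a b; decide +kernel

theorem bell_amplitude_eq_zero (i j a b : Fin 4) (h : i ^^^ j ≠ a ^^^ b) :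
    ∑ x : Fin 2 → Fin 2, ∑ y : Fin 2 → Fin 2,
      bell i x * bell j y * (bell a ![x 0, y 0] * bell b ![x 1, y 1]) = 0 := by
  have hs : ∀ f : (Fin 2 → Fin 2) → ℂ, ∑ x, f x = ∑ s, ∑ t, f ![s, t] := by
    intro f
    rw [← (finTwoArrowEquiv (Fin 2)).symm.sum_comp, Fintype.sum_prod_type]
    rfl
  have h' := congrArg (Int.cast : ℤ → ℂ) (sum_bellCoeff_swap i j a b h)
  push_cast at h'
  simp only [hs, bell_apply]
  calc _ = (1 / 2 * (1 / 2) : ℂ) * ∑ s, ∑ t, ∑ u, ∑ v,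
      (bellCoeff i s t * bellCoeff j u v * (bellCoeff a s u * bellCoeff b t v) : ℂ) := by
        simp only [Finset.mul_sum, ← inv_sqrt_two_mul_self]
        refine Finset.sum_congr rfl fun s _ => Finset.sum_congr rfl fun t _ =>
          Finset.sum_congr rfl fun u _ => Finset.sum_congr rfl fun v _ => ?_
        simp only [Matrix.cons_val_zero, Matrix.cons_val_one]
        ring
    _ = 0 := by rw [h', mul_zero]

/-! ### Two shared Bell states across the bipartite cut. -/

theorem shared_bell_apply (e : Fin 3 ↪ Fin 4) (a : Fin 2 ↪ Fin 3) (x : ∀ p, Copies Qubits 2 p) :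
    shared (threeBell e) a x =
      bell (e (a 0)) ![x 0 0, x 1 0] * bell (e (a 1)) ![x 0 1, x 1 1] := by
  have hx : ∀ k, (fun p => x p k) = ![x 0 k, x 1 k] := fun k => by
    funext p; fin_cases p <;> rfl
  simp only [shared, threeBell, Fin.prod_univ_two, hx]

/-- Across the cut the coefficient matrix is half a signed permutation matrix, the permutation being
translation by the two flip bits; hence the state is maximally entangled. -/
theorem shared_bell_apply_eq_ite (e : Fin 3 ↪ Fin 4) (a : Fin 2 ↪ Fin 3)
    (x : ∀ p, Copies Qubits 2 p) :
    shared (threeBell e) a x =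
      if x 1 = Equiv.addRight (fun k => bellFlip (e (a k))) (x 0) then
        1 / 2 * ((bellSign (e (a 0)) (x 0 0) * bellSign (e (a 1)) (x 0 1) : ℤ) : ℂ) else 0 := by
  have hx : x 1 = Equiv.addRight (fun k => bellFlip (e (a k))) (x 0) ↔
      x 1 0 = x 0 0 + bellFlip (e (a 0)) ∧ x 1 1 = x 0 1 + bellFlip (e (a 1)) := by
    rw [funext_iff, Fin.forall_fin_two]; rfl
  rw [shared_bell_apply, bell_apply, bell_apply, if_congr hx rfl rfl, ← inv_sqrt_two_mul_self]
  simp only [Matrix.cons_val_zero, Matrix.cons_val_one, bellCoeff]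
  by_cases h0 : x 1 0 = x 0 0 + bellFlip (e (a 0)) <;>
    by_cases h1 : x 1 1 = x 0 1 + bellFlip (e (a 1)) <;> simp only [h0, h1, and_self, and_true,
      and_false, if_true, if_false, Int.cast_zero, mul_zero, zero_mul]
  push_cast
  ring

theorem norm_bellSign_mul (i j : Fin 4) (s t : Fin 2) :
    ‖(1 / 2 * ((bellSign i s * bellSign j t : ℤ) : ℂ))‖ ^ 2 = 1 / 4 := by
  have h : bellSign i s * bellSign j t = 1 ∨ bellSign i s * bellSign j t = -1 := by
    unfold bellSign; split_ifs <;> simp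
  rcases h with h | h <;> rw [h] <;> norm_num

theorem norm_sq_shared_bell (e : Fin 3 ↪ Fin 4) (a : Fin 2 ↪ Fin 3) :
    ‖shared (threeBell e) a‖ ^ 2 = 1 := by
  rw [EuclideanSpace.norm_sq_eq, ← (piFinTwoEquiv (Copies Qubits 2)).symm.sum_comp,
    Fintype.sum_prod_type]
  simp only [shared_bell_apply_eq_ite, apply_ite (fun c : ℂ => ‖c‖ ^ 2), norm_bellSign_mul]
  simp [piFinTwoEquiv]

theorem productBounded_shared_bell (e : Fin 3 ↪ Fin 4) (a : Fin 2 ↪ Fin 3) :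
    ProductBounded (1 / 4) (shared (threeBell e) a) :=
  productBounded_of_equiv (X := Copies Qubits 2) _
    (Equiv.addRight fun k => bellFlip (e (a k)))
    (fun x => 1 / 2 * ((bellSign (e (a 0)) (x 0) * bellSign (e (a 1)) (x 1) : ℤ) : ℂ))
    (fun x => (norm_bellSign_mul (e (a 0)) (e (a 1)) (x 0) (x 1)).le)
    (shared_bell_apply_eq_ite e a)

theorem not_markable_threeBell (e : Fin 3 ↪ Fin 4) : ¬ Markable (threeBell e) 2 := by
  rintro ⟨π, hπ⟩
  have h := card_le_of_distinguishes _ (productBounded_shared_bell e) π hπ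
  have hL : Fintype.card (Fin 2 ↪ Fin 3) = 6 := by
    simp [Fintype.card_embedding_eq, Nat.descFactorial]
  have hX : Fintype.card (∀ p, Copies Qubits 2 p) = 16 := by simp
  -- The bound would read 6 ≤ 16/4.
  rw [hL, hX] at h
  norm_num at h

/-! ### The identifying protocol. -/

/-- The pair of family members whose product in the Klein four-group matches the outcomes. -/
def bellOut (e : Fin 3 ↪ Fin 4) (i j : Fin 4) : Finset (Fin 3) :=
  {k | ∃ k', k' ≠ k ∧ e k ^^^ e k' = i ^^^ j}

theorem bellOut_eq (e : Fin 3 ↪ Fin 4) (a : Fin 2 ↪ Fin 3) (i j : Fin 4)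
    (h : i ^^^ j = e (a 0) ^^^ e (a 1)) : bellOut e i j = Finset.univ.map a := by
  -- Cancellation in the Klein four-group, checked over all injective triples.
  have key : ∀ f : Fin 3 → Fin 4, f 0 ≠ f 1 → f 0 ≠ f 2 → f 1 ≠ f 2 →
      ∀ k l : Fin 3, k ≠ l →
      ∀ r, (∃ k', k' ≠ r ∧ f r ^^^ f k' = f k ^^^ f l) ↔ k = r ∨ l = r := by
    decide +kernel
  ext k
  rw [bellOut, h, Finset.mem_filter_univ, key e (e.injective.ne (by decide))
    (e.injective.ne (by decide)) (e.injective.ne (by decide)) _ _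
    (a.injective.ne (by decide : (0 : Fin 2) ≠ 1))]
  simp

/-- Both projectors have rank one, so each entry of the result is a multiple of the swapping
amplitude, which vanishes. -/
theorem applyAt_bellProj_applyAt_bellProj (e : Fin 3 ↪ Fin 4) (a : Fin 2 ↪ Fin 3) (i j : Fin 4)
    (h : i ^^^ j ≠ e (a 0) ^^^ e (a 1)) :
    applyAt (Z := Copies Qubits 2) 1 (bellProj j)
      (applyAt (Z := Copies Qubits 2) 0 (bellProj i) (shared (threeBell e) a)) = 0 := by
  ext z
  have h0 := bell_amplitude_eq_zero i j _ _ h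
  simp only [applyAt, bellProj, Matrix.of_apply, star_bell_apply, shared_bell_apply]
  rw [Finset.sum_comm] at h0
  trans bell j (z 1) * bell i (z 0) * 0
  · rw [← h0, Finset.mul_sum]
    refine Finset.sum_congr rfl fun y _ => ?_
    rw [Finset.mul_sum, Finset.mul_sum]
    refine Finset.sum_congr rfl fun x _ => ?_
    simp
    ring
  · simp

theorem bellProtocol_identifies (e : Fin 3 ↪ Fin 4) :
    (bellProtocol (bellOut e)).Identifies (threeBell e) := by
  intro a
  let R : Rounds (Copies Qubits 2) (Finset (Fin 3)) :=
    .measure 0 4 bellProj bellProj_complete fun i =>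
      .measure 1 4 bellProj bellProj_complete fun j => .output (bellOut e i j)
  have hprob : (bellProtocol (bellOut e)).prob (shared (threeBell e) a) (Finset.univ.map a) =
      R.prob (Finset.univ.map a) (shared (threeBell e) a) :=
    congrArg (R.prob (Finset.univ.map a)) (applyLocal_one _)
  -- Writing 1 as the total probability over all outputs leaves only the vanishing of the wrong ones
  -- to prove.
  rw [hprob, ← norm_sq_shared_bell e a, ← R.sum_prob]
  symm
  refine Finset.sum_eq_single_of_mem _ (Finset.mem_univ _) fun l _ hl => ?_
  simp only [R, Rounds.prob]
  refine Finset.sum_eq_zero fun i _ => Finset.sum_eq_zero fun j _ => ?_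
  split_ifs with hout
  · rw [applyAt_bellProj_applyAt_bellProj]
    · simp
    · exact fun h => hl (hout ▸ bellOut_eq e a i j h)
  · rfl

end LocalSubset
end

theorem theorem32 :
    (¬ ∀ (N : ℕ) (d : Fin N → ℕ) (n m : ℕ) (ψ : Fin n → LocalSubset.Vec fun p => Fin (d p)),
        Orthonormal ℂ ψ → 1 ≤ m → m < n →
          LocalSubset.Identifiable ψ m → LocalSubset.Markable ψ m) ∧
    ∀ e : Fin 3 ↪ Fin 4,
      Orthonormal ℂ (LocalSubset.threeBell e) ∧
      (∃ out : Fin 4 → Fin 4 → Finset (Fin 3),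
        (LocalSubset.bellProtocol out).Identifies (LocalSubset.threeBell e)) ∧
      LocalSubset.Identifiable (LocalSubset.threeBell e) 2 ∧
      ¬ LocalSubset.Markable (LocalSubset.threeBell e) 2 := by
  have main : ∀ e : Fin 3 ↪ Fin 4,
      Orthonormal ℂ (LocalSubset.threeBell e) ∧
      (∃ out : Fin 4 → Fin 4 → Finset (Fin 3),
        (LocalSubset.bellProtocol out).Identifies (LocalSubset.threeBell e)) ∧
      LocalSubset.Identifiable (LocalSubset.threeBell e) 2 ∧
      ¬ LocalSubset.Markable (LocalSubset.threeBell e) 2 := fun e =>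
    ⟨LocalSubset.orthonormal_bell.comp e e.injective,
      ⟨_, LocalSubset.bellProtocol_identifies e⟩, ⟨_, LocalSubset.bellProtocol_identifies e⟩,
      LocalSubset.not_markable_threeBell e⟩
  refine ⟨fun h => ?_, main⟩
  obtain ⟨horth, -, hid, hmark⟩ := main Fin.castSuccEmb
  exact hmark (h 2 (fun _ => 2) 3 2 _ horth (by norm_num) (by norm_num) hid)
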